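/- Let $x_1,\dots,x_n$ be points with a distance function $D$, and let $G$ be a directed graph on $\{1,\dots,n\}$. Greedy search for a query $q$, started at a node $s$, sets $j\leftarrow s$ and repeats the following. If $j$ has no out-neighbor, stop. Otherwise let $h$ be the out-neighbor of $j$ that minimizes $D(q,x_h)$, with ties broken in favor of the lowest index. If $D(q,x_h)<D(q,x_j)$, or $D(q,x_h)=D(q,x_j)$ and $h<j$, set $j\leftarrow h$; otherwise stop. On stopping, the search returns $x_j$. The graph $G$ is *navigable* for $x_1,\dots,x_n$ under $D$ if for all $s,t\in\{1,\dots,n\}$ greedy search for the query $x_t$ started at $s$ returns $x_t$. The average degree of $G$ is its number of (directed) edges divided by $n$. **Theorem 2.** There are universal constants $c>0$ and $C>0$ such that the following holds for every fixed $\delta>0$. Let $x_1,\dots,x_n\in\mathbb{R}^d$ be random vectors whose entries are i.i.d. uniform on $\{-1,1\}$, where $d\ge \frac{c}{\delta^2}\log_2 n$, and let $D(x_i,x_j)=\|x_i-x_j\|_2$ be the Euclidean distance. Then, with probability tending to $1$ as $n\to\infty$, uniformly over all such $d$, every directed graph that is navigable for $x_1,\dots,x_n$ under $D$ has average degree at least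 $C\,n^{1/2-\delta}$. That is, for every $\eta>0$ there is an $N=N(\delta,\eta)$ such that for all $n\ge N$ and all $d\ge\frac{c}{\delta^2}\log_2 n$ this holds with probability at least $1-\eta$. -/

import Mathlib

open MeasureTheory ProbabilityTheory

/-- `h` is the out-neighbor of `j` in `G` whose point is nearest to the query `q`; among several
nearest out-neighbors it is the one with the lowest id. -/
def IsBestOutNeighbor {𝒳 : Type*} {n : ℕ} (G : Digraph (Fin n)) (D : 𝒳 → 𝒳 → ℝ)
    (x : Fin n → 𝒳) (q : 𝒳) (j h : Fin n) : Prop :=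
  G.Adj j h ∧
    ∀ i, G.Adj j i → D q (x h) < D q (x i) ∨ (D q (x h) = D q (x i) ∧ h ≤ i)

/-- The test under which greedy search moves from `j` to `h`: the point of `h` is strictly closer
to the query, or it is at the same distance and `h` has the lower id. -/
def GreedyImproves {𝒳 : Type*} {n : ℕ} (D : 𝒳 → 𝒳 → ℝ)
    (x : Fin n → 𝒳) (q : 𝒳) (j h : Fin n) : Prop :=
  D q (x h) < D q (x j) ∨ (D q (x h) = D q (x j) ∧ h < j)

/-- `GreedyReturns G D x q s r`: greedy search on `G` with query `q`, started at node `s`,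
terminates at node `r` (and so returns the point `x r`). -/
inductive GreedyReturns {𝒳 : Type*} {n : ℕ} (G : Digraph (Fin n)) (D : 𝒳 → 𝒳 → ℝ)
    (x : Fin n → 𝒳) (q : 𝒳) : Fin n → Fin n → Prop
  | no_neighbor (j : Fin n) (hj : ∀ i, ¬ G.Adj j i) : GreedyReturns G D x q j j
  | halt (j h : Fin n) (hbest : IsBestOutNeighbor G D x q j h)
      (himp : ¬ GreedyImproves D x q j h) : GreedyReturns G D x q j j
  | move (j h r : Fin n) (hbest : IsBestOutNeighbor G D x q j h)
      (himp : GreedyImproves D x q j h) (hrun : GreedyReturns G D x q h r) :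
      GreedyReturns G D x q j r

/-- `G` is navigable for `x` under `D`: for all nodes `s`, `t`, greedy search started at `s` with
query `x t` terminates and returns the point `x t`. -/
def Navigable {𝒳 : Type*} {n : ℕ} (G : Digraph (Fin n)) (D : 𝒳 → 𝒳 → ℝ)
    (x : Fin n → 𝒳) : Prop :=
  ∀ s t : Fin n, ∃ r : Fin n, GreedyReturns G D x (x t) s r ∧ x r = x t

/-- The average (out-)degree of a directed graph on `n` nodes: number of edges divided by `n`. -/
noncomputable def averageDegree {n : ℕ} (G : Digraph (Fin n)) : ℝ :=
  (Set.ncard {e : Fin n × Fin n | G.Adj e.1 e.2} : ℝ) / (n : ℝ)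

/-- The entries `X i k` (`i < n`, `k < d`) are i.i.d. uniform random signs on `(Ω, P)`. -/
structure IsRandomSignMatrix {Ω : Type*} [MeasurableSpace Ω] (P : Measure Ω) {n d : ℕ}
    (X : Fin n → Fin d → Ω → ℝ) : Prop where
  measurable : ∀ i k, Measurable (X i k)
  indep : iIndepFun (fun p : Fin n × Fin d => X p.1 p.2) P
  prob_one : ∀ i k, P {ω | X i k ω = 1} = 1 / 2
  prob_neg_one : ∀ i k, P {ω | X i k ω = -1} = 1 / 2

/-- The points of Euclidean space whose coordinates are the rows of `X` at the outcome `ω`. -/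
noncomputable def rowPoints {Ω : Type*} {n d : ℕ} (X : Fin n → Fin d → Ω → ℝ) (ω : Ω) :
    Fin n → EuclideanSpace ℝ (Fin d) :=
  fun i => WithLp.toLp 2 (fun k => X i k ω)

/-! Call a pair close if the inner product of its sign vectors is at least a threshold `τ`. Since
all points have squared norm `d`, this means distance at most some `r`. For a close pair `(t, j)` of
distinct points, the search for `x t` started at `j` must leave `j` along an edge `(j, h)` with `h`
no farther from `x t`. So `t` lies in both balls of radius `r` around `j` and `h`, or `t = h`. If
any two nodes have at most `K` common close nodes, an edge serves at most `K + 1` targets, and the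
number of close pairs is at most `K + 1` times the number of edges (`Navigable.card_le`).

It remains to choose `τ` so that close pairs are many and common close nodes few. Rows are nearly
orthogonal with high probability; a random vector is then close to two given rows with probability
about the square of the probability `p` of being close to one (`unifProb_le_signInner_and_le`). With
`p` slightly below `n^(-1/2)`, the expected number of common close nodes is a negative power of `n`,
and a union bound over sets of `K + 1` nodes gives a `K` depending only on `δ`. The number of close
pairs concentrates near its mean, of order `n² p`, by Chebyshev (`unifProb_relCount_lt_le`), where
`p` is bounded below by exponential tilting (`le_unifProb_sum`). Dividing by `n (K + 1)` leaves at
least `n^(1/2 - δ)`. -/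

open Finset Function
open scoped BigOperators

/-! ### Uniform probability on finite product spaces. -/

section Uniform

variable {α : Type*} [Fintype α] {ι V : Type*} [Fintype ι] [DecidableEq ι] [Fintype V]

open scoped Classical in
/-- The probability of a predicate under the uniform distribution on a finite type. -/
noncomputable def unifProb (A : α → Prop) : ℝ := 𝔼 a, if A a then (1 : ℝ) else 0

theorem unifProb_nonneg (A : α → Prop) : 0 ≤ unifProb A :=
  Finset.expect_nonneg fun a _ => by split_ifs <;> norm_num

theorem expect_mono {f g : α → ℝ} (h : ∀ a, f a ≤ g a) : 𝔼 a, f a ≤ 𝔼 a, g a :=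
  Finset.expect_le_expect fun a _ => h a

theorem unifProb_mono {A B : α → Prop} (h : ∀ a, A a → B a) : unifProb A ≤ unifProb B := by
  classical
  refine expect_mono fun a => ?_
  by_cases hA : A a
  · simp [hA, h a hA]
  · simp only [hA, if_false]
    split_ifs <;> norm_num

theorem unifProb_or_le (A B : α → Prop) :
    unifProb (fun a => A a ∨ B a) ≤ unifProb A + unifProb B := by
  classical
  unfold unifProb
  rw [← Finset.expect_add_distrib]
  refine expect_mono fun a => ?_
  by_cases hA : A a <;> by_cases hB : B a <;> simp [hA, hB]

theorem unifProb_exists_le {κ : Type*} (I : Finset κ) (A : κ → α → Prop) :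
    unifProb (fun a => ∃ i ∈ I, A i a) ≤ ∑ i ∈ I, unifProb (A i) := by
  classical
  unfold unifProb
  rw [← Finset.expect_sum_comm]
  refine expect_mono fun a => ?_
  split_ifs with h
  · obtain ⟨i, hi, hA⟩ := h
    refine le_trans ?_ (Finset.single_le_sum (f := fun i => if A i a then (1 : ℝ) else 0)
      (fun j _ => by split_ifs <;> norm_num) hi)
    simp [hA]
  · exact Finset.sum_nonneg fun j _ => by split_ifs <;> norm_num

theorem unifProb_not [Nonempty α] (A : α → Prop) :
    unifProb (fun a => ¬ A a) = 1 - unifProb A := by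
  classical
  unfold unifProb
  rw [eq_sub_iff_add_eq, ← Finset.expect_add_distrib]
  refine (Finset.expect_congr rfl fun a _ => ?_).trans (Fintype.expect_const (1 : ℝ))
  by_cases h : A a <;> simp [h]

/-- Markov's inequality for the uniform distribution. -/
theorem unifProb_le_of_mul_le (A : α → Prop) (f : α → ℝ) (c : ℝ) (hf : ∀ a, 0 ≤ f a)
    (h : ∀ a, A a → 1 ≤ c * f a) (hc : 0 ≤ c) : unifProb A ≤ c * 𝔼 a, f a := by
  classical
  unfold unifProb
  rw [Finset.mul_expect]
  refine expect_mono fun a => ?_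
  split_ifs with hA
  · exact h a hA
  · exact mul_nonneg hc (hf a)

/-- Resampling one coordinate does not change averages over a product. -/
theorem expect_update (w : ι) (F : (ι → V) → ℝ) :
    𝔼 s, 𝔼 v, F (update s w v) = 𝔼 s, F s := by
  classical
  rcases isEmpty_or_nonempty V with hV | hV
  · have : IsEmpty (ι → V) := ⟨fun s => hV.elim (s w)⟩
    simp
  -- Exchanging the fresh value with the old coordinate is a bijection, so it preserves the uniform
  -- average.
  have hinv : Involutive (fun p : (ι → V) × V => (update p.1 w p.2, p.1 w)) := by
    rintro ⟨s, v⟩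
    simp
  have h1 : 𝔼 p : (ι → V) × V, F (update p.1 w p.2) = 𝔼 p : (ι → V) × V, F p.1 :=
    Fintype.expect_equiv hinv.toPerm _ _ fun p => rfl
  have h2 := Finset.expect_product (s := (univ : Finset (ι → V))) (t := (univ : Finset V))
    (fun p => F (update p.1 w p.2))
  have h3 := Finset.expect_product (s := (univ : Finset (ι → V))) (t := (univ : Finset V))
    (fun p => F p.1)
  rw [Finset.univ_product_univ] at h2 h3
  rw [← h2, h1, h3]
  simp

/-- If `i ≠ j`, the pair of coordinates `i`, `j` satisfies a relation with probability at most `q`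
as soon as each section of the relation does. -/
theorem unifProb_pair_le [Nonempty V] {i j : ι} (hij : i ≠ j) (R : V → V → Prop) (q : ℝ)
    (h : ∀ v, unifProb (fun u => R u v) ≤ q) :
    unifProb (fun s : ι → V => R (s i) (s j)) ≤ q := by
  classical
  unfold unifProb at h ⊢
  rw [← expect_update i]
  calc _ ≤ 𝔼 _s : ι → V, q := expect_mono fun s => by
          simpa [update_of_ne hij.symm] using h (s j)
    _ = q := by simp

/-- Given two coordinates in good position, the events attached to further coordinates multiply. -/
theorem unifProb_forall_le [Nonempty V] {i j : ι} (good : V → V → Prop)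
    (R : V → V → V → Prop) {q : ℝ} (hq : 0 ≤ q)
    (h : ∀ u v, good u v → unifProb (fun w => R u v w) ≤ q)
    (T : Finset ι) (hi : i ∉ T) (hj : j ∉ T) :
    unifProb (fun s : ι → V => good (s i) (s j) ∧ ∀ t ∈ T, R (s i) (s j) (s t)) ≤ q ^ T.card := by
  classical
  induction T using Finset.induction_on with
  | empty =>
    calc _ ≤ 𝔼 _s : ι → V, (1 : ℝ) := expect_mono fun s => by split_ifs <;> norm_num
      _ = q ^ (∅ : Finset ι).card := by simp
  | insert w T hw ih =>
    simp only [Finset.mem_insert, not_or] at hi hj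
    specialize ih hi.2 hj.2
    rw [Finset.card_insert_of_notMem hw, pow_succ']
    refine le_trans ?_ (mul_le_mul_of_nonneg_left ih hq)
    unfold unifProb
    rw [Finset.mul_expect, ← expect_update w]
    refine expect_mono fun s => ?_
    have hT : ∀ v, ∀ t ∈ T, update s w v t = s t := fun v t ht =>
      update_of_ne (ne_of_mem_of_not_mem ht hw) _ _
    by_cases hg : good (s i) (s j) ∧ ∀ t ∈ T, R (s i) (s j) (s t)
    · rw [if_pos hg, mul_one]
      refine le_trans (expect_mono fun v => ?_) (h (s i) (s j) hg.1)
      beta_reduce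
      rw [update_of_ne hi.1, update_of_ne hj.1]
      split_ifs with h1 h2 h2
      · exact le_rfl
      · exact absurd (by simpa using h1.2 w (Finset.mem_insert_self _ _)) h2
      · norm_num
      · exact le_rfl
    · rw [if_neg hg, mul_zero]
      refine le_of_eq (Finset.expect_eq_zero fun v _ => ?_)
      beta_reduce
      rw [update_of_ne hi.1, update_of_ne hj.1, if_neg]
      rintro ⟨h1, h2⟩
      refine hg ⟨h1, fun t ht => ?_⟩
      have := h2 t (Finset.mem_insert_of_mem ht)
      rwa [hT v t ht] at this

end Uniform

/-! ### Second moment of the number of related pairs. -/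

section PairCount

variable {ι V : Type*} [Fintype ι] [DecidableEq ι] [Fintype V]

open scoped Classical in
/-- The number of pairs in `I` whose coordinates are related by `R`. -/
noncomputable def relCount (R : V → V → Prop) (I : Finset (ι × ι)) (s : ι → V) : ℝ :=
  ∑ a ∈ I, if R (s a.1) (s a.2) then (1 : ℝ) else 0

-- With every coordinate except `w` frozen, `f` is constant and the relation has conditional
-- probability `p` whatever `s w'` is.
open scoped Classical in
theorem expect_mul_rel {w w' : ι} (hw : w ≠ w') (R : V → V → Prop) {p : ℝ}
    (hp : ∀ v, unifProb (fun u => R u v) = p) (f : (ι → V) → ℝ)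
    (hf : ∀ s v, f (update s w v) = f s) :
    𝔼 s, f s * (if R (s w) (s w') then (1 : ℝ) else 0) = p * 𝔼 s, f s := by
  rw [← expect_update w, Finset.mul_expect]
  refine Finset.expect_congr rfl fun s _ => ?_
  simp only [hf, update_self, update_of_ne hw.symm]
  rw [← Finset.mul_expect, mul_comm]
  congr 1
  exact hp (s w')

open scoped Classical in
theorem expect_rel [Nonempty V] {w w' : ι} (hw : w ≠ w') (R : V → V → Prop) {p : ℝ}
    (hp : ∀ v, unifProb (fun u => R u v) = p) :
    𝔼 s : ι → V, (if R (s w) (s w') then (1 : ℝ) else 0) = p := by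
  simpa using expect_mul_rel hw R hp (fun _ => 1) fun _ _ => rfl

-- Even pairs sharing a vertex are uncorrelated: two distinct increasing pairs always leave one
-- endpoint of `b` outside `a`, and resampling that endpoint factors out `p`. Symmetry of `R` lets
-- it be either endpoint.
open scoped Classical in
theorem expect_rel_mul_rel [Nonempty V] [LinearOrder ι] (R : V → V → Prop) (hR : ∀ u v, R u v → R v u) {p : ℝ}
    (hp : ∀ v, unifProb (fun u => R u v) = p) {a b : ι × ι} (ha : a.1 < a.2) (hb : b.1 < b.2)
    (hab : a ≠ b) :
    𝔼 s : ι → V, (if R (s a.1) (s a.2) then (1 : ℝ) else 0) *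
      (if R (s b.1) (s b.2) then (1 : ℝ) else 0) = p ^ 2 := by
  by_cases h1 : b.1 = a.1 ∨ b.1 = a.2
  · have h2 : b.2 ≠ a.1 ∧ b.2 ≠ a.2 := by
      rcases h1 with h1 | h1
      · refine ⟨fun h => ?_, fun h => hab (Prod.ext h1.symm h.symm)⟩
        rw [h1, h] at hb; exact lt_irrefl _ hb
      · refine ⟨fun h => ?_, fun h => ?_⟩
        · rw [h1, h] at hb; exact lt_asymm ha hb
        · rw [h1, h] at hb; exact lt_irrefl _ hb
    have hcomm : ∀ s : ι → V, R (s b.1) (s b.2) ↔ R (s b.2) (s b.1) := fun s => ⟨hR _ _, hR _ _⟩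
    simp only [hcomm]
    rw [expect_mul_rel hb.ne' R hp (fun s => if R (s a.1) (s a.2) then (1 : ℝ) else 0)
      (fun s v => by simp only [update_of_ne h2.1.symm, update_of_ne h2.2.symm]),
      expect_rel ha.ne R hp, sq]
  · push Not at h1
    rw [expect_mul_rel hb.ne R hp (fun s => if R (s a.1) (s a.2) then (1 : ℝ) else 0)
      (fun s v => by simp only [update_of_ne h1.1.symm, update_of_ne h1.2.symm]),
      expect_rel ha.ne R hp, sq]

theorem expect_relCount_sub_sq_le [Nonempty V] [LinearOrder ι] (R : V → V → Prop) (hR : ∀ u v, R u v → R v u)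
    {p : ℝ} (hp : ∀ v, unifProb (fun u => R u v) = p) (I : Finset (ι × ι))
    (hI : ∀ a ∈ I, a.1 < a.2) :
    𝔼 s : ι → V, (relCount R I s - I.card * p) ^ 2 ≤ I.card * p := by
  classical
  set g : ι × ι → (ι → V) → ℝ := fun a s => if R (s a.1) (s a.2) then (1 : ℝ) else 0 with hg
  have hp0 : 0 ≤ p := by
    rw [← hp (Classical.arbitrary V)]; exact unifProb_nonneg _
  have hexp : ∀ s, (relCount R I s - I.card * p) ^ 2 =
      ∑ a ∈ I, ∑ b ∈ I, (g a s * g b s - p * g a s - p * g b s + p ^ 2) := by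
    intro s
    have : relCount R I s - I.card * p = ∑ a ∈ I, (g a s - p) := by
      simp [relCount, hg, Finset.sum_sub_distrib]
    rw [this, sq, Finset.sum_mul_sum]
    refine Finset.sum_congr rfl fun a _ => Finset.sum_congr rfl fun b _ => by ring
  simp only [hexp]
  rw [Finset.expect_sum_comm]
  have hrow : ∀ a ∈ I,
      𝔼 s, ∑ b ∈ I, (g a s * g b s - p * g a s - p * g b s + p ^ 2) ≤ p := by
    intro a ha
    rw [Finset.expect_sum_comm]
    -- The covariance matrix is diagonal, so the variance of the count is at most its mean.
    have hterm : ∀ b ∈ I, 𝔼 s, (g a s * g b s - p * g a s - p * g b s + p ^ 2)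
        = if b = a then p - p ^ 2 else 0 := by
      intro b hb
      have e1 : 𝔼 s, g a s = p := expect_rel (hI a ha).ne R hp
      have e2 : 𝔼 s, g b s = p := expect_rel (hI b hb).ne R hp
      have e3 : 𝔼 s, (g a s * g b s - p * g a s - p * g b s + p ^ 2) =
          (𝔼 s, g a s * g b s) - p ^ 2 := by
        rw [Finset.expect_add_distrib, Finset.expect_sub_distrib, Finset.expect_sub_distrib,
          ← Finset.mul_expect, ← Finset.mul_expect, e1, e2]
        simp; ring
      rw [e3]
      split_ifs with hba
      · subst hba
        have : ∀ s, g b s * g b s = g b s := fun s => by simp [hg]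
        simp only [this, e2]
      · rw [expect_rel_mul_rel R hR hp (hI a ha) (hI b hb) (Ne.symm hba), sub_self]
    rw [Finset.sum_congr rfl hterm]
    simp only [Finset.sum_ite_eq', ha, if_true]
    nlinarith [sq_nonneg p]
  calc _ ≤ ∑ a ∈ I, p := Finset.sum_le_sum hrow
    _ = _ := by simp

/-- Chebyshev's inequality for the number of related pairs. -/
theorem unifProb_relCount_lt_le [Nonempty V] [LinearOrder ι] (R : V → V → Prop) (hR : ∀ u v, R u v → R v u)
    {p : ℝ} (hp : ∀ v, unifProb (fun u => R u v) = p) (I : Finset (ι × ι))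
    (hI : ∀ a ∈ I, a.1 < a.2) (hpos : 0 < I.card * p) :
    unifProb (fun s : ι → V => relCount R I s < I.card * p / 2) ≤ 4 / (I.card * p) := by
  set m := I.card * p with hm
  have := unifProb_le_of_mul_le (fun s : ι → V => relCount R I s < m / 2)
    (fun s => (relCount R I s - m) ^ 2) (4 / m ^ 2) (fun s => sq_nonneg _)
    (fun s hs => by
      rw [div_mul_eq_mul_div, le_div_iff₀ (by positivity)]
      nlinarith) (by positivity)
  refine this.trans ?_
  have h2 := expect_relCount_sub_sq_le R hR hp I hI
  calc 4 / m ^ 2 * _ ≤ 4 / m ^ 2 * m := mul_le_mul_of_nonneg_left h2 (by positivity)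
    _ = 4 / m := by field_simp

end PairCount

/-! ### Upper and lower tail bounds for sums of random signs. -/

section Signs

/-- The sign encoded by a Boolean. -/
def boolSign (b : Bool) : ℝ := if b then 1 else -1

theorem boolSign_sq (b : Bool) : boolSign b ^ 2 = 1 := by cases b <;> simp [boolSign]

theorem boolSign_beq (a b : Bool) : boolSign (a == b) = boolSign a * boolSign b := by
  cases a <;> cases b <;> simp [boolSign]

theorem abs_boolSign (b : Bool) : |boolSign b| = 1 := by cases b <;> simp [boolSign]

theorem expect_bool (f : Bool → ℝ) : 𝔼 b, f b = (f true + f false) / 2 := by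
  rw [Fintype.expect_eq_sum_div_card, Fintype.sum_bool]; simp

theorem expect_prod_bool {d : ℕ} (f : Fin d → Bool → ℝ) :
    𝔼 u : Fin d → Bool, ∏ k, f k (u k) = ∏ k, 𝔼 b, f k b := by
  simp only [Fintype.expect_eq_sum_div_card]
  rw [Finset.prod_div_distrib, Fintype.prod_sum]
  simp

/-- The inner product of two sign vectors. -/
def signInner {d : ℕ} (u v : Fin d → Bool) : ℝ := ∑ k, boolSign (u k) * boolSign (v k)

theorem signInner_comm {d : ℕ} (u v : Fin d → Bool) : signInner u v = signInner v u :=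
  Finset.sum_congr rfl fun _ _ => mul_comm _ _

theorem expect_exp_le {d : ℕ} (a : Fin d → ℝ) :
    𝔼 u : Fin d → Bool, Real.exp (∑ k, a k * boolSign (u k)) ≤ Real.exp ((∑ k, a k ^ 2) / 2) := by
  simp only [Real.exp_sum]
  rw [expect_prod_bool (fun k b => Real.exp (a k * boolSign b)), Finset.sum_div, Real.exp_sum]
  refine Finset.prod_le_prod (fun _ _ => ?_) fun k _ => ?_
  · rw [expect_bool]; positivity
  · rw [expect_bool]
    simpa [boolSign, Real.cosh_eq] using Real.cosh_le_exp_half_sq (a k)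

/-- Hoeffding's inequality for sign vectors. -/
theorem unifProb_le_sum_le {d : ℕ} (a : Fin d → ℝ) {B τ : ℝ} (hB : 0 < B) (hτ : 0 ≤ τ)
    (ha : ∑ k, a k ^ 2 ≤ B) :
    unifProb (fun u : Fin d → Bool => τ ≤ ∑ k, a k * boolSign (u k)) ≤
      Real.exp (-τ ^ 2 / (2 * B)) := by
  -- The minimizer of the Chernoff exponent `l ^ 2 * B / 2 - l * τ`.
  set l := τ / B with hl
  have hl0 : 0 ≤ l := by positivity
  have h1 := unifProb_le_of_mul_le (fun u : Fin d → Bool => τ ≤ ∑ k, a k * boolSign (u k))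
    (fun u => Real.exp (∑ k, (l * a k) * boolSign (u k))) (Real.exp (-(l * τ)))
    (fun u => (Real.exp_pos _).le) (fun u hu => by
      rw [← Real.exp_add]
      refine Real.one_le_exp ?_
      simp only [mul_assoc]
      rw [← Finset.mul_sum]
      nlinarith [mul_le_mul_of_nonneg_left hu hl0]) (Real.exp_pos _).le
  refine h1.trans ((mul_le_mul_of_nonneg_left (expect_exp_le _) (Real.exp_pos _).le).trans ?_)
  rw [← Real.exp_add]
  refine Real.exp_le_exp.2 ?_
  simp only [mul_pow]
  rw [← Finset.mul_sum]
  have h2 : l ^ 2 * ∑ k, a k ^ 2 ≤ l ^ 2 * B := mul_le_mul_of_nonneg_left ha (sq_nonneg _)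
  have h3 : l ^ 2 * B = l * τ := by rw [hl]; field_simp
  have h4 : -τ ^ 2 / (2 * B) = -(l * τ) / 2 := by rw [hl]; field_simp
  rw [h4]
  linarith

theorem unifProb_le_signInner_le {d : ℕ} (hd : 0 < d) (v : Fin d → Bool) {τ : ℝ} (hτ : 0 ≤ τ) :
    unifProb (fun u => τ ≤ signInner u v) ≤ Real.exp (-τ ^ 2 / (2 * d)) := by
  have := unifProb_le_sum_le (fun k => boolSign (v k)) (B := d) (by exact_mod_cast hd) hτ
    (by simp [boolSign_sq])
  simpa only [signInner, mul_comm (boolSign (v _))] using this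

/-- For two nearly orthogonal sign vectors, few sign vectors are close to both. -/
theorem unifProb_le_signInner_and_le {d : ℕ} (hd : 0 < d) (u v : Fin d → Bool) {ε τ : ℝ}
    (hε : 0 ≤ ε) (hτ : 0 ≤ τ) (huv : signInner u v ≤ ε * d) :
    unifProb (fun w => τ ≤ signInner w u ∧ τ ≤ signInner w v) ≤
      Real.exp (-τ ^ 2 / (d * (1 + ε))) := by
  have hd' : (0 : ℝ) < d := by exact_mod_cast hd
  have hsum : ∑ k, (boolSign (u k) + boolSign (v k)) ^ 2 = 2 * d + 2 * signInner u v := by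
    simp only [add_sq, boolSign_sq, Finset.sum_add_distrib, signInner, Finset.mul_sum]
    simp [mul_assoc]; ring
  -- Adding the two conditions turns them into one, on the inner product with `u + v`, whose squared
  -- norm is only about `2 * d`. This is what makes the bound roughly the square of the one for a
  -- single vector.
  have := unifProb_le_sum_le (fun k => boolSign (u k) + boolSign (v k)) (B := 2 * (d * (1 + ε)))
    (τ := 2 * τ) (by positivity) (by positivity) (by rw [hsum]; linarith)
  refine le_trans (unifProb_mono fun w hw => ?_) (this.trans (le_of_eq ?_))
  · have : ∑ k, (boolSign (u k) + boolSign (v k)) * boolSign (w k) =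
        signInner w u + signInner w v := by
      rw [signInner, signInner, ← Finset.sum_add_distrib]
      exact Finset.sum_congr rfl fun k _ => by ring
    rw [this]
    linarith [hw.1, hw.2]
  · congr 1; field_simp

/-- Flipping the signs of `u` where `v` is negative preserves the uniform law, so the probability
does not depend on `v`, as the pair count requires. -/
theorem unifProb_signInner_eq {d : ℕ} (τ : ℝ) (v : Fin d → Bool) :
    unifProb (fun u => τ ≤ signInner u v) =
      unifProb (fun u : Fin d → Bool => τ ≤ ∑ k, boolSign (u k)) := by
  classical
  have hinv : Involutive (fun (u : Fin d → Bool) k => u k == v k) := fun u => by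
    funext k; cases h : u k <;> cases h' : v k <;> simp [h, h']
  unfold unifProb
  refine Fintype.expect_equiv hinv.toPerm _ _ fun u => ?_
  simp [signInner, boolSign_beq]
  congr

theorem unifProb_eq_const {d : ℕ} (v : Fin d → Bool) :
    unifProb (fun u => u = v) = (2 ^ d : ℝ)⁻¹ := by
  classical
  unfold unifProb
  rw [Fintype.expect_eq_sum_div_card]
  beta_reduce
  rw [Fintype.sum_eq_single v fun x hx => by simp [hx]]
  simp

theorem expect_fin_succ {d : ℕ} (F : (Fin (d + 1) → Bool) → ℝ) :
    𝔼 u, F u = 𝔼 b, 𝔼 u : Fin d → Bool, F (Fin.cons b u) := by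
  have h := Finset.expect_product (s := (univ : Finset Bool)) (t := (univ : Finset (Fin d → Bool)))
    (fun p => F (Fin.cons p.1 p.2))
  rw [Finset.univ_product_univ] at h
  rw [← h]
  exact Fintype.expect_equiv (Fin.consEquiv fun _ => Bool).symm _ _ fun u => by
    simp [Fin.consEquiv]

/-- The first moments of a sum of signs with bias `θ`. -/
theorem expect_tilted (θ : ℝ) (d : ℕ) :
    (𝔼 u : Fin d → Bool, ∏ k, (1 + θ * boolSign (u k)) = 1) ∧
    (𝔼 u : Fin d → Bool, (∏ k, (1 + θ * boolSign (u k))) * (∑ k, boolSign (u k) - d * θ) = 0) ∧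
    (𝔼 u : Fin d → Bool, (∏ k, (1 + θ * boolSign (u k))) * (∑ k, boolSign (u k) - d * θ) ^ 2 =
      d * (1 - θ ^ 2)) := by
  induction d with
  | zero => simp
  | succ d ih =>
    obtain ⟨h0, h1, h2⟩ := ih
    set W : (Fin d → Bool) → ℝ := fun u => ∏ k, (1 + θ * boolSign (u k)) with hW
    set Z : (Fin d → Bool) → ℝ := fun u => ∑ k, boolSign (u k) - d * θ with hZ
    change 𝔼 u, W u = 1 at h0
    change 𝔼 u, W u * Z u = 0 at h1
    change 𝔼 u, W u * Z u ^ 2 = _ at h2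
    simp only [expect_fin_succ, Fin.prod_univ_succ, Fin.sum_univ_succ, Fin.cons_zero,
      Fin.cons_succ]
    have e0 : ∀ b, 𝔼 u : Fin d → Bool, (1 + θ * boolSign b) * ∏ k, (1 + θ * boolSign (u k)) =
        1 + θ * boolSign b := fun b => by
      rw [← Finset.mul_expect]
      change _ * 𝔼 u, W u = _
      rw [h0, mul_one]
    have e1 : ∀ b, 𝔼 u : Fin d → Bool, (1 + θ * boolSign b) * (∏ k, (1 + θ * boolSign (u k))) *
        (boolSign b + ∑ k, boolSign (u k) - ((d + 1 : ℕ) : ℝ) * θ) =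
        (1 + θ * boolSign b) * (boolSign b - θ) := fun b => by
      have : ∀ u : Fin d → Bool, (1 + θ * boolSign b) * (∏ k, (1 + θ * boolSign (u k))) *
        (boolSign b + ∑ k, boolSign (u k) - ((d + 1 : ℕ) : ℝ) * θ) =
          (1 + θ * boolSign b) * (W u * Z u) +
            (1 + θ * boolSign b) * (boolSign b - θ) * W u := fun u => by
        simp only [hW, hZ]; push_cast; ring
      rw [Finset.expect_congr rfl fun u _ => this u, Finset.expect_add_distrib,
        ← Finset.mul_expect, ← Finset.mul_expect, h0, h1]
      ring
    have e2 : ∀ b, 𝔼 u : Fin d → Bool, (1 + θ * boolSign b) * (∏ k, (1 + θ * boolSign (u k))) *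
        (boolSign b + ∑ k, boolSign (u k) - ((d + 1 : ℕ) : ℝ) * θ) ^ 2 =
        (1 + θ * boolSign b) * (d * (1 - θ ^ 2) + (boolSign b - θ) ^ 2) := fun b => by
      have : ∀ u : Fin d → Bool, (1 + θ * boolSign b) * (∏ k, (1 + θ * boolSign (u k))) *
        (boolSign b + ∑ k, boolSign (u k) - ((d + 1 : ℕ) : ℝ) * θ) ^ 2 =
          (1 + θ * boolSign b) * (W u * Z u ^ 2) +
          (1 + θ * boolSign b) * (2 * (boolSign b - θ)) * (W u * Z u) +
            (1 + θ * boolSign b) * (boolSign b - θ) ^ 2 * W u := fun u => by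
        simp only [hW, hZ]; push_cast; ring
      rw [Finset.expect_congr rfl fun u _ => this u, Finset.expect_add_distrib,
        Finset.expect_add_distrib, ← Finset.mul_expect, ← Finset.mul_expect,
        ← Finset.mul_expect, h0, h1, h2]
      ring
    refine ⟨?_, ?_, ?_⟩
    · simp only [e0]; simp only [expect_bool, boolSign]; norm_num; ring
    · simp only [e1]; simp only [expect_bool, boolSign]; norm_num; ring
    · simp only [e2]; simp only [expect_bool, boolSign]; push_cast; norm_num; ring

/-- Taylor expansion of the logarithm to second order; the quadratic term is deterministic because
`x` is `θ` or `-θ`. -/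
theorem one_add_le_exp_cubic {x θ : ℝ} (hx : |x| = θ) (hθ : θ ≤ 1 / 2) :
    1 + x ≤ Real.exp (x - θ ^ 2 / 2 + 2 * θ ^ 3) := by
  have hθ0 : 0 ≤ θ := hx ▸ abs_nonneg x
  have hpos : 0 < 1 + x := by
    have := neg_abs_le x
    linarith
  have h := Real.abs_log_sub_add_sum_range_le (x := -x) (by rw [abs_neg]; linarith) 2
  rw [abs_neg, hx] at h
  have h2 : θ ^ (2 + 1) / (1 - θ) ≤ 2 * θ ^ 3 := by
    rw [div_le_iff₀ (by linarith), show θ ^ (2 + 1) = θ ^ 3 from rfl]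
    nlinarith [mul_nonneg (pow_nonneg hθ0 3) (by linarith : 0 ≤ 1 - 2 * θ)]
  have h3 := (abs_le.1 h).2
  simp only [Finset.sum_range_succ, Finset.sum_range_zero] at h3
  norm_num at h3
  have hx2 : x ^ 2 = θ ^ 2 := by rw [← hx, sq_abs]
  rw [← Real.log_le_iff_le_exp hpos]
  norm_num at h2
  linarith

/-- A lower bound for the upper tail of a sum of random signs. -/
theorem le_unifProb_sum {d : ℕ} (hd : 0 < d) {θ : ℝ} (hθ0 : 0 ≤ θ) (hθ : θ ≤ 1 / 2) :
    3 / 4 * Real.exp (-(d * θ ^ 2 / 2 + 2 * √d * θ + 2 * d * θ ^ 3)) ≤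
      unifProb (fun u : Fin d → Bool => d * θ - 2 * √d ≤ ∑ k, boolSign (u k)) := by
  classical
  have hd' : (0 : ℝ) < d := by exact_mod_cast hd
  have hsd : √(d : ℝ) ^ 2 = d := Real.sq_sqrt hd'.le
  have hsd0 : 0 < √(d : ℝ) := Real.sqrt_pos.2 hd'
  set W : (Fin d → Bool) → ℝ := fun u => ∏ k, (1 + θ * boolSign (u k)) with hW
  set Z : (Fin d → Bool) → ℝ := fun u => ∑ k, boolSign (u k) - d * θ with hZ
  set M := Real.exp (d * θ ^ 2 / 2 + 2 * √d * θ + 2 * d * θ ^ 3) with hM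
  obtain ⟨h0, -, h2⟩ := expect_tilted θ d
  change 𝔼 u, W u = 1 at h0
  change 𝔼 u, W u * Z u ^ 2 = _ at h2
  have habs : ∀ b, |θ * boolSign b| = θ := fun b => by
    rw [abs_mul, abs_boolSign, mul_one, abs_of_nonneg hθ0]
  have hfac : ∀ b, 0 ≤ 1 + θ * boolSign b := fun b => by
    have := neg_abs_le (θ * boolSign b)
    rw [habs] at this
    linarith
  have hW0 : ∀ u, 0 ≤ W u := fun u => Finset.prod_nonneg fun k _ => hfac _
  have hWle : ∀ u, Z u ≤ 2 * √d → W u ≤ M := fun u hu => by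
    calc W u ≤ ∏ k : Fin d, Real.exp (θ * boolSign (u k) - θ ^ 2 / 2 + 2 * θ ^ 3) :=
          Finset.prod_le_prod (fun _ _ => hfac _) fun k _ => one_add_le_exp_cubic (habs _) hθ
      _ = Real.exp (θ * ∑ k, boolSign (u k) - d * θ ^ 2 / 2 + 2 * d * θ ^ 3) := by
          rw [← Real.exp_sum]
          congr 1
          rw [Finset.sum_add_distrib, Finset.sum_sub_distrib, ← Finset.mul_sum]
          simp
          ring
      _ ≤ M := by
          refine Real.exp_le_exp.2 ?_
          have := mul_le_mul_of_nonneg_left hu hθ0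
          simp only [hZ] at this
          nlinarith
  -- `W` is the density of the law with mean sign `θ`. The left side is positive only within two
  -- standard-deviation bounds `√d` of the tilted mean; there the tail event holds and `W` is at
  -- most `M`.
  have hpt : ∀ u, W u * (1 - Z u ^ 2 / (4 * d)) ≤
      M * if d * θ - 2 * √d ≤ ∑ k, boolSign (u k) then 1 else 0 := fun u => by
    by_cases hu : |Z u| ≤ 2 * √d
    · rw [if_pos (by have := (abs_le.1 hu).1; simp only [hZ] at this; linarith), mul_one]
      refine le_trans ?_ (hWle u (abs_le.1 hu).2)
      refine mul_le_of_le_one_right (hW0 u) ?_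
      have : 0 ≤ Z u ^ 2 / (4 * d) := by positivity
      linarith
    · refine le_trans (mul_nonpos_of_nonneg_of_nonpos (hW0 u) ?_) ?_
      · rw [sub_nonpos, le_div_iff₀ (by positivity), one_mul, ← sq_abs]
        push Not at hu
        nlinarith
      · split_ifs <;> simp [hM, Real.exp_nonneg]
  -- Chebyshev under the tilted law: the variance `d * (1 - θ ^ 2)` is at most `d`, so at most `1 /
  -- 4` is lost.
  have hmean : 3 / 4 ≤ 𝔼 u, W u * (1 - Z u ^ 2 / (4 * d)) := by
    have : ∀ u, W u * (1 - Z u ^ 2 / (4 * d)) = W u - 1 / (4 * d) * (W u * Z u ^ 2) := fun u => by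
      ring
    rw [Finset.expect_congr rfl fun u _ => this u, Finset.expect_sub_distrib, ← Finset.mul_expect,
      h0, h2]
    have e : 1 / (4 * (d : ℝ)) * (d * (1 - θ ^ 2)) = (1 - θ ^ 2) / 4 := by field_simp
    rw [e]
    nlinarith [sq_nonneg θ]
  have hfin := hmean.trans (expect_mono hpt)
  rw [← Finset.mul_expect] at hfin
  rw [Real.exp_neg, ← hM, ← div_eq_mul_inv, div_le_iff₀ (Real.exp_pos _), mul_comm]
  exact hfin

end Signs

/-! ### From the uniform law on sign matrices to an arbitrary probability space. -/

section Transfer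

variable {Ω : Type*} {n d : ℕ} {X : Fin n → Fin d → Ω → ℝ}

/-- The outcomes at which the sign matrix has a given value. -/
def signEvent (X : Fin n → Fin d → Ω → ℝ) (s : Fin n → Fin d → Bool) : Set Ω :=
  {ω | ∀ i k, X i k ω = boolSign (s i k)}

theorem boolSign_injective : Injective boolSign := by
  intro a b h
  cases a <;> cases b <;> simp [boolSign] at h ⊢ <;> norm_num at h

theorem signEvent_disjoint {s t : Fin n → Fin d → Bool} (h : s ≠ t) :
    Disjoint (signEvent X s) (signEvent X t) := by
  refine Set.disjoint_left.2 fun ω hs ht => h ?_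
  funext i k
  exact boolSign_injective ((hs i k).symm.trans (ht i k))

theorem signEvent_eq_iInter (s : Fin n → Fin d → Bool) :
    signEvent X s = ⋂ p ∈ (univ : Finset (Fin n × Fin d)),
      X p.1 p.2 ⁻¹' {boolSign (s p.1 p.2)} := by
  ext ω
  simp [signEvent]

variable [MeasurableSpace Ω] {P : Measure Ω}

theorem IsRandomSignMatrix.measurableSet_signEvent (hX : IsRandomSignMatrix P X)
    (s : Fin n → Fin d → Bool) : MeasurableSet (signEvent X s) := by
  rw [signEvent_eq_iInter]
  exact Finset.measurableSet_biInter _ fun p _ => hX.measurable _ _ (measurableSet_singleton _)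

theorem IsRandomSignMatrix.measureReal_signEvent (hX : IsRandomSignMatrix P X)
    (s : Fin n → Fin d → Bool) :
    P.real (signEvent X s) = (Fintype.card (Fin n → Fin d → Bool) : ℝ)⁻¹ := by
  have h : ∀ p : Fin n × Fin d, P (X p.1 p.2 ⁻¹' {boolSign (s p.1 p.2)}) = 1 / 2 := fun p => by
    cases hs : s p.1 p.2
    · exact hX.prob_neg_one p.1 p.2
    · exact hX.prob_one p.1 p.2
  rw [Measure.real, signEvent_eq_iInter,
    hX.indep.measure_inter_preimage_eq_mul univ fun p _ => measurableSet_singleton _,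
    Finset.prod_congr rfl fun p _ => h p]
  simp [pow_mul, mul_comm n d]

/-- A property implied by a property of the sign matrix has at least its uniform probability. -/
theorem IsRandomSignMatrix.unifProb_le [IsProbabilityMeasure P] (hX : IsRandomSignMatrix P X)
    (A : (Fin n → Fin d → Bool) → Prop) (S : Set Ω)
    (h : ∀ s ω, A s → ω ∈ signEvent X s → ω ∈ S) : unifProb A ≤ P.real S := by
  classical
  -- Only the atoms need to be measurable; `S` itself may fail to be, since monotonicity of the
  -- measure suffices.
  have hsub : (⋃ s ∈ univ.filter A, signEvent X s) ⊆ S := by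
    intro ω hω
    simp only [Set.mem_iUnion, Finset.mem_filter, Finset.mem_univ, true_and] at hω
    obtain ⟨s, hs, hω⟩ := hω
    exact h s ω hs hω
  refine le_trans (le_of_eq ?_) (measureReal_mono hsub)
  rw [measureReal_biUnion_finset (fun s _ t _ hst => signEvent_disjoint hst)
    fun s _ => hX.measurableSet_signEvent s, Finset.sum_congr rfl
    fun s _ => hX.measureReal_signEvent s, unifProb, Fintype.expect_eq_sum_div_card]
  simp [div_eq_mul_inv]

end Transfer

/-! ### Counting edges of a navigable graph. -/

section Deterministic

variable {𝒳 : Type*} {n : ℕ} {G : Digraph (Fin n)} {D : 𝒳 → 𝒳 → ℝ} {x : Fin n → 𝒳}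

theorem Navigable.exists_adj (hG : Navigable G D x) {j t : Fin n} (h : x j ≠ x t) :
    ∃ i, G.Adj j i ∧ i ≠ j ∧ D (x t) (x i) ≤ D (x t) (x j) := by
  obtain ⟨r, hr, hrt⟩ := hG j t
  cases hr with
  | no_neighbor => exact absurd hrt h
  | halt => exact absurd hrt h
  | move _ i _ hbest himp _ =>
    refine ⟨i, hbest.1, ?_, ?_⟩
    · rintro rfl
      rcases himp with h1 | h1
      · exact lt_irrefl _ h1
      · exact lt_irrefl _ h1.2
    · rcases himp with h1 | h1
      · exact h1.le
      · exact h1.1.le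

theorem Navigable.one_le_edges (hG : Navigable G D x) {j t : Fin n} (h : x j ≠ x t) :
    1 ≤ Set.ncard {e : Fin n × Fin n | G.Adj e.1 e.2} := by
  obtain ⟨i, hi, -⟩ := hG.exists_adj h
  exact (Set.ncard_pos (Set.toFinite _)).2 ⟨(j, i), hi⟩

open scoped Classical in
/-- If any two nodes lie in at most `K` common balls of radius `r` around other nodes, a navigable
graph has many edges. -/
theorem Navigable.card_le (hG : Navigable G D x) (r : ℝ) {K : ℕ} (I : Finset (Fin n × Fin n))
    (hI : ∀ a ∈ I, a.1 ≠ a.2) (hr : ∀ a ∈ I, D (x a.1) (x a.2) ≤ r)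
    (hne : ∀ a ∈ I, x a.2 ≠ x a.1)
    (hK : ∀ j h, j ≠ h → (univ.filter fun t => t ≠ j ∧ t ≠ h ∧ D (x t) (x j) ≤ r ∧
      D (x t) (x h) ≤ r).card ≤ K) :
    I.card ≤ (K + 1) * Set.ncard {e : Fin n × Fin n | G.Adj e.1 e.2} := by
  have hex : ∀ a : Fin n × Fin n, ∃ i, a ∈ I →
      G.Adj a.2 i ∧ i ≠ a.2 ∧ D (x a.1) (x i) ≤ D (x a.1) (x a.2) := fun a => by
    by_cases ha : a ∈ I
    · obtain ⟨i, hi⟩ := hG.exists_adj (hne a ha)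
      exact ⟨i, fun _ => hi⟩
    · exact ⟨a.1, fun h => absurd h ha⟩
  choose f hf using hex
  rw [Set.ncard_eq_toFinset_card']
  set E := {e : Fin n × Fin n | G.Adj e.1 e.2}.toFinset.filter fun e => e.1 ≠ e.2 with hE
  have hEle : E.card ≤ {e : Fin n × Fin n | G.Adj e.1 e.2}.toFinset.card :=
    Finset.card_filter_le _ _
  refine le_trans ?_ (Nat.mul_le_mul_left _ hEle)
  refine Finset.card_le_mul_card_image_of_maps_to (f := fun a : Fin n × Fin n => (a.2, f a)) ?_ _ ?_
  · intro a ha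
    simp only [hE, Finset.mem_filter, Set.mem_toFinset, Set.mem_ofPred_eq]
    exact ⟨(hf a ha).1, (hf a ha).2.1.symm⟩
  · rintro ⟨j, h⟩ hjh
    simp only [hE, Finset.mem_filter] at hjh
    -- Targets served by the edge `(j, h)`. The inserted `h` is the target reached by the edge
    -- itself, and gives the `+ 1` in `K + 1`.
    have hsub : (I.filter fun a => ((a.2, f a) : Fin n × Fin n) = (j, h)) ⊆
        (insert h (univ.filter fun t => t ≠ j ∧ t ≠ h ∧ D (x t) (x j) ≤ r ∧
          D (x t) (x h) ≤ r)).image fun t => (t, j) := by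
      rintro ⟨t, j'⟩ ha
      simp only [Finset.mem_filter, Prod.mk.injEq] at ha
      obtain ⟨haI, rfl, hfh⟩ := ha
      simp only [Finset.mem_image, Finset.mem_insert, Finset.mem_filter, Finset.mem_univ, true_and,
        Prod.mk.injEq, and_true, exists_eq_right]
      by_cases hth : t = h
      · exact Or.inl hth
      · refine Or.inr ⟨hI _ haI, hth, hr _ haI, ?_⟩
        have := (hf _ haI).2.2
        rw [hfh] at this
        exact this.trans (hr _ haI)
    calc _ ≤ _ := Finset.card_le_card hsub
      _ ≤ _ := Finset.card_image_le
      _ ≤ _ := Finset.card_insert_le _ _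
      _ ≤ K + 1 := Nat.add_le_add_right (hK j h hjh.2) 1

end Deterministic

/-! ### Distances between sign vectors in terms of inner products. -/

section Points

variable {n d : ℕ}

/-- The points of Euclidean space with given sign vectors. -/
noncomputable def signPoints (s : Fin n → Fin d → Bool) : Fin n → EuclideanSpace ℝ (Fin d) :=
  fun i => WithLp.toLp 2 fun k => boolSign (s i k)

theorem rowPoints_eq_signPoints {Ω : Type*} {X : Fin n → Fin d → Ω → ℝ}
    {s : Fin n → Fin d → Bool} {ω : Ω} (h : ω ∈ signEvent X s) :
    rowPoints X ω = signPoints s := by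
  funext i
  simp only [rowPoints, signPoints]
  congr 1
  funext k
  exact h i k

theorem dist_signPoints_sq (s : Fin n → Fin d → Bool) (i j : Fin n) :
    dist (signPoints s i) (signPoints s j) ^ 2 = 2 * d - 2 * signInner (s i) (s j) := by
  rw [EuclideanSpace.dist_sq_eq]
  simp only [signPoints, Real.dist_eq, sq_abs, sub_sq, boolSign_sq, signInner, Finset.mul_sum,
    Finset.sum_add_distrib, Finset.sum_sub_distrib]
  simp [mul_assoc]
  ring

theorem dist_signPoints_le_iff (s : Fin n → Fin d → Bool) (i j : Fin n) (τ : ℝ) (hτ : τ ≤ d) :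
    dist (signPoints s i) (signPoints s j) ≤ √(2 * d - 2 * τ) ↔ τ ≤ signInner (s i) (s j) := by
  rw [Real.le_sqrt dist_nonneg, dist_signPoints_sq]
  · constructor <;> intro h <;> linarith
  · linarith

theorem signInner_self (u : Fin d → Bool) : signInner u u = d := by
  simp [signInner, ← sq, boolSign_sq]

theorem signPoints_eq_iff (s : Fin n → Fin d → Bool) (i j : Fin n) :
    signPoints s i = signPoints s j ↔ s i = s j := by
  constructor
  · intro h
    funext k
    refine boolSign_injective ?_
    simpa [signPoints] using congrArg (fun v : EuclideanSpace ℝ (Fin d) => v k) h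
  · intro h; simp only [signPoints, h]

end Points

/-! ### Typical sign matrices. -/

section Typical

/-- The pairs `a.1 < a.2`. -/
def ltPairs (n : ℕ) : Finset (Fin n × Fin n) := univ.filter fun a => a.1 < a.2

theorem sq_le_four_mul_card_ltPairs {n : ℕ} (hn : 2 ≤ n) :
    (n : ℝ) ^ 2 / 4 ≤ (ltPairs n).card := by
  have h1 : ((univ : Finset (Fin n)).offDiag).card ≤ 2 * (ltPairs n).card := by
    have hsub : (univ : Finset (Fin n)).offDiag ⊆ ltPairs n ∪ (ltPairs n).image Prod.swap := by
      rintro ⟨a, b⟩ h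
      simp only [Finset.mem_offDiag, Finset.mem_univ, true_and] at h
      rcases lt_or_gt_of_ne h with h | h
      · exact Finset.mem_union_left _ (by simpa [ltPairs] using h)
      · exact Finset.mem_union_right _ (Finset.mem_image.2 ⟨(b, a), by simpa [ltPairs] using h, rfl⟩)
    calc _ ≤ _ := Finset.card_le_card hsub
      _ ≤ _ := Finset.card_union_le _ _
      _ ≤ (ltPairs n).card + (ltPairs n).card := Nat.add_le_add_left Finset.card_image_le _
      _ = _ := by ring
  rw [Finset.offDiag_card, Finset.card_univ, Fintype.card_fin] at h1
  have h2 : n * n ≤ 2 * (ltPairs n).card + n := by omega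
  have h3 : (n : ℝ) * n ≤ 2 * (ltPairs n).card + n := by exact_mod_cast h2
  have h4 : (2 : ℝ) ≤ n := by exact_mod_cast hn
  nlinarith

variable {n d : ℕ}

/-- The rows of the sign matrix are pairwise nearly orthogonal. -/
def NearlyOrthogonal (ε : ℝ) (s : Fin n → Fin d → Bool) : Prop :=
  ∀ i j, i ≠ j → signInner (s i) (s j) ≤ ε * d

open scoped Classical in
/-- The rows close to both `s i` and `s j`. -/
noncomputable def commonNeighbors (τ : ℝ) (s : Fin n → Fin d → Bool) (i j : Fin n) :
    Finset (Fin n) :=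
  univ.filter fun t => t ≠ i ∧ t ≠ j ∧ τ ≤ signInner (s t) (s i) ∧ τ ≤ signInner (s t) (s j)

theorem unifProb_not_nearlyOrthogonal_le (hd : 0 < d) {ε : ℝ} (hε : 0 ≤ ε) :
    unifProb (fun s : Fin n → Fin d → Bool => ¬ NearlyOrthogonal ε s) ≤
      n ^ 2 * Real.exp (-(ε ^ 2 * d) / 2) := by
  classical
  have hd' : (0 : ℝ) < d := by exact_mod_cast hd
  calc _ ≤ unifProb (fun s : Fin n → Fin d → Bool => ∃ a ∈ (univ : Finset (Fin n)).offDiag,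
          ε * d ≤ signInner (s a.1) (s a.2)) := unifProb_mono fun s hs => by
        simp only [NearlyOrthogonal, not_forall, not_le] at hs
        obtain ⟨i, j, hij, h⟩ := hs
        exact ⟨(i, j), by simpa using hij, h.le⟩
    _ ≤ ∑ a ∈ (univ : Finset (Fin n)).offDiag, Real.exp (-(ε ^ 2 * d) / 2) := by
        refine (unifProb_exists_le _ _).trans (Finset.sum_le_sum fun a ha => ?_)
        refine unifProb_pair_le (by simpa using ha)
          (fun u v : Fin d → Bool => ε * d ≤ signInner u v) _ fun v => ?_
        refine (unifProb_le_signInner_le hd v (by positivity)).trans (le_of_eq ?_)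
        congr 1; field_simp
    _ ≤ _ := by
        rw [Finset.sum_const, nsmul_eq_mul]
        refine mul_le_mul_of_nonneg_right ?_ (Real.exp_pos _).le
        rw [Finset.offDiag_card, Finset.card_univ, Fintype.card_fin, sq]
        exact_mod_cast Nat.sub_le _ _

/-- Union bound over the pair and over the sets of `K + 1` common close rows. For a fixed nearly
orthogonal pair the other rows are independent, so the probabilities multiply. -/
theorem unifProb_lt_card_commonNeighbors_le (hd : 0 < d) {ε τ : ℝ} (hε : 0 ≤ ε) (hτ : 0 ≤ τ)
    (K : ℕ) :
    unifProb (fun s : Fin n → Fin d → Bool => NearlyOrthogonal ε s ∧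
      ∃ i j, i ≠ j ∧ K < (commonNeighbors τ s i j).card) ≤
      n ^ 2 * (n * Real.exp (-τ ^ 2 / (d * (1 + ε)))) ^ (K + 1) := by
  classical
  set q := Real.exp (-τ ^ 2 / (d * (1 + ε))) with hq
  set J : Fin n × Fin n → Finset (Finset (Fin n)) := fun a =>
    ((univ.erase a.1).erase a.2).powersetCard (K + 1) with hJ
  calc _ ≤ unifProb (fun s : Fin n → Fin d → Bool => ∃ a ∈ (univ : Finset (Fin n)).offDiag,
          ∃ T ∈ J a, signInner (s a.1) (s a.2) ≤ ε * d ∧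
            ∀ t ∈ T, τ ≤ signInner (s t) (s a.1) ∧ τ ≤ signInner (s t) (s a.2)) :=
        unifProb_mono fun s hs => by
          obtain ⟨ho, i, j, hij, hK⟩ := hs
          obtain ⟨T, hT, hcard⟩ := Finset.exists_subset_card_eq (Nat.succ_le_of_lt hK)
          have hmem : ∀ t ∈ T, t ≠ i ∧ t ≠ j ∧ τ ≤ signInner (s t) (s i) ∧
              τ ≤ signInner (s t) (s j) := fun t ht => by
            simpa [commonNeighbors] using hT ht
          refine ⟨(i, j), by simpa using hij, T, ?_, ho i j hij, fun t ht => (hmem t ht).2.2⟩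
          rw [hJ, Finset.mem_powersetCard]
          refine ⟨fun t ht => ?_, hcard⟩
          simp [(hmem t ht).1, (hmem t ht).2.1]
    _ ≤ ∑ a ∈ (univ : Finset (Fin n)).offDiag, ∑ T ∈ J a, q ^ (K + 1) := by
        refine (unifProb_exists_le _ _).trans (Finset.sum_le_sum fun a ha => ?_)
        refine (unifProb_exists_le _ _).trans (Finset.sum_le_sum fun T hT => ?_)
        rw [hJ, Finset.mem_powersetCard] at hT
        rw [← hT.2]
        refine unifProb_forall_le (fun u v : Fin d → Bool => signInner u v ≤ ε * d)
          (fun u v w => τ ≤ signInner w u ∧ τ ≤ signInner w v) (Real.exp_pos _).le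
          (fun u v huv => unifProb_le_signInner_and_le hd u v hε hτ huv) T
          (fun h => ?_) (fun h => ?_)
        · simpa using hT.1 h
        · simpa using hT.1 h
    _ ≤ ∑ a ∈ (univ : Finset (Fin n)).offDiag, (n * q) ^ (K + 1) := by
        refine Finset.sum_le_sum fun a _ => ?_
        rw [Finset.sum_const, nsmul_eq_mul, mul_pow]
        refine mul_le_mul_of_nonneg_right ?_ (pow_nonneg (Real.exp_pos _).le _)
        rw [hJ, Finset.card_powersetCard]
        have h1 : ((univ.erase a.1).erase a.2 : Finset (Fin n)).card ≤ n := by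
          simpa using Finset.card_le_univ ((univ.erase a.1).erase a.2 : Finset (Fin n))
        exact_mod_cast (Nat.choose_le_pow _ _).trans (Nat.pow_le_pow_left h1 _)
    _ ≤ _ := by
        rw [Finset.sum_const, nsmul_eq_mul]
        refine mul_le_mul_of_nonneg_right ?_ (by positivity)
        rw [Finset.offDiag_card, Finset.card_univ, Fintype.card_fin, sq]
        exact_mod_cast Nat.sub_le _ _

/-- Navigable graphs on typical sign vectors have many edges. -/
theorem Navigable.relCount_le {ε τ : ℝ} {K : ℕ} {s : Fin n → Fin d → Bool} (hd : 0 < d)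
    (hε : ε < 1) (hτ : τ ≤ d) (ho : NearlyOrthogonal ε s)
    (hK : ∀ i j, i ≠ j → (commonNeighbors τ s i j).card ≤ K) {G : Digraph (Fin n)}
    (hG : Navigable G (fun u v : EuclideanSpace ℝ (Fin d) => dist u v) (signPoints s)) :
    relCount (fun u v => τ ≤ signInner u v) (ltPairs n) s ≤
      (K + 1) * Set.ncard {e : Fin n × Fin n | G.Adj e.1 e.2} := by
  classical
  have hd' : (0 : ℝ) < d := by exact_mod_cast hd
  have h := hG.card_le (√(2 * d - 2 * τ)) (K := K)
    ((ltPairs n).filter fun a => τ ≤ signInner (s a.1) (s a.2)) ?_ ?_ ?_ ?_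
  · have h' : (((ltPairs n).filter fun a => τ ≤ signInner (s a.1) (s a.2)).card : ℝ) ≤
        (K + 1) * Set.ncard {e : Fin n × Fin n | G.Adj e.1 e.2} := by exact_mod_cast h
    refine le_trans (le_of_eq ?_) h'
    rw [relCount]
    simp
  · intro a ha
    simp only [ltPairs, Finset.mem_filter, Finset.mem_univ, true_and] at ha
    exact ha.1.ne
  · intro a ha
    exact (dist_signPoints_le_iff s _ _ _ hτ).2 (Finset.mem_filter.1 ha).2
  -- Equal points would have inner product `d`, which near orthogonality with `ε < 1` forbids.
  · intro a ha heq
    simp only [ltPairs, Finset.mem_filter, Finset.mem_univ, true_and] at ha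
    have := ho _ _ ha.1.ne
    rw [(signPoints_eq_iff s _ _).1 heq, signInner_self] at this
    nlinarith
  · intro j h hjh
    refine le_trans (le_of_eq ?_) (hK j h hjh)
    simp only [commonNeighbors, dist_signPoints_le_iff s _ _ _ hτ]

theorem unifProb_relCount_ge (hn : 2 ≤ n) (hd : 0 < d) {ε τ p₀ : ℝ} (hε : 0 ≤ ε)
    (hτ : 0 ≤ τ) (K : ℕ) (hp₀ : 0 < p₀)
    (hp : p₀ ≤ unifProb (fun u : Fin d → Bool => τ ≤ ∑ k, boolSign (u k))) :
    1 - (n ^ 2 * Real.exp (-(ε ^ 2 * d) / 2) +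
      n ^ 2 * (n * Real.exp (-τ ^ 2 / (d * (1 + ε)))) ^ (K + 1) + 16 / (n ^ 2 * p₀)) ≤
    unifProb (fun s : Fin n → Fin d → Bool => NearlyOrthogonal ε s ∧
      (∀ i j, i ≠ j → (commonNeighbors τ s i j).card ≤ K) ∧
      n ^ 2 * p₀ / 8 ≤ relCount (fun u v => τ ≤ signInner u v) (ltPairs n) s) := by
  set p := unifProb (fun u : Fin d → Bool => τ ≤ ∑ k, boolSign (u k)) with hpdef
  have hM := sq_le_four_mul_card_ltPairs hn
  have hn' : (0 : ℝ) < n := by exact_mod_cast (by omega : 0 < n)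
  have hMp : n ^ 2 / 4 * p₀ ≤ (ltPairs n).card * p :=
    mul_le_mul hM hp hp₀.le (by positivity)
  have hpos : (0 : ℝ) < n ^ 2 / 4 * p₀ := by positivity
  have hcount := unifProb_relCount_lt_le (ι := Fin n) (fun u v : Fin d → Bool => τ ≤ signInner u v)
    (fun u v h => by rwa [signInner_comm]) (p := p) (fun v => unifProb_signInner_eq τ v)
    (ltPairs n) (fun a ha => by simpa [ltPairs] using ha) (hpos.trans_le hMp)
  have hcount' : 4 / ((ltPairs n).card * p) ≤ 16 / (n ^ 2 * p₀) := by
    calc _ ≤ 4 / (n ^ 2 / 4 * p₀) := div_le_div_of_nonneg_left (by norm_num) hpos hMp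
      _ = _ := by field_simp; norm_num
  rw [sub_le_comm, ← unifProb_not]
  refine le_trans (unifProb_mono (B := fun s => (¬ NearlyOrthogonal ε s ∨
    (NearlyOrthogonal ε s ∧ ∃ i j, i ≠ j ∧ K < (commonNeighbors τ s i j).card)) ∨
    relCount (fun u v => τ ≤ signInner u v) (ltPairs n) s < (ltPairs n).card * p / 2)
    fun s hs => ?_) ?_
  · by_contra hcon
    push Not at hcon
    obtain ⟨⟨h1, h2⟩, h3⟩ := hcon
    exact hs ⟨h1, h2 h1, by linarith⟩
  · refine (unifProb_or_le _ _).trans (add_le_add ((unifProb_or_le _ _).trans (add_le_add ?_ ?_))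
      (hcount.trans hcount'))
    · exact unifProb_not_nearlyOrthogonal_le hd hε
    · exact unifProb_lt_card_commonNeighbors_le hd hε hτ K

end Typical

/-! ### Choice of threshold and tolerance. -/

section Parameters

/-- Here `L` stands for `log n`. With `A = √((1 + δ) * L)` and `θ = A / √d` the threshold is `√d *
(A - 2)`. The lower-tail exponent is `A ^ 2 / 2 + 2 * A` plus a cubic term, and `0.945 = 0.5 + 0.32
+ 0.1 + 0.025` collects the contributions of `A ≤ 0.16 * δ * L`, `θ ≤ δ / 20` and `δ ≤ 1 / 4`. The
choice `ε ^ 2 * d = 6 * L` makes the union bound over pairs equal to `n ^ 2 * n ^ (-3)`. -/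
theorem exists_parameters {δ L d : ℝ} (hδ : 0 < δ) (hδ' : δ ≤ 1 / 4) (hd : 0 < d)
    (hL : 50 ≤ δ ^ 2 * L) (hLd : 600 * L ≤ δ ^ 2 * d) :
    ∃ θ ε : ℝ, 0 ≤ θ ∧ θ ≤ 1 / 2 ∧ 0 ≤ ε ∧ ε < 1 ∧ ε ^ 2 * d = 6 * L ∧
      0 ≤ d * θ - 2 * √d ∧ d * θ - 2 * √d ≤ d ∧
      d * θ ^ 2 / 2 + 2 * √d * θ + 2 * d * θ ^ 3 ≤ (1 / 2 + 0.945 * δ) * L ∧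
      (1 + δ / 4) * L ≤ (d * θ - 2 * √d) ^ 2 / (d * (1 + ε)) := by
  have hL0 : 0 < L := by
    by_contra h
    push Not at h
    nlinarith [sq_nonneg δ]
  have hLδ : 200 ≤ δ * L := by nlinarith
  set r := √d with hr
  have hr0 : 0 < r := Real.sqrt_pos.2 hd
  have hrd : r ^ 2 = d := Real.sq_sqrt hd.le
  set A := √((1 + δ) * L) with hA
  have hA0 : 0 ≤ A := Real.sqrt_nonneg _
  have hA2 : A ^ 2 = (1 + δ) * L := Real.sq_sqrt (by positivity)
  have hAle : A ≤ 0.16 * δ * L := by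
    refine abs_le_of_sq_le_sq' ?_ (by positivity) |>.2
    rw [hA2]
    nlinarith [mul_le_mul_of_nonneg_right hL hL0.le]
  have hA4 : 4 ≤ A := by
    refine abs_le_of_sq_le_sq' ?_ hA0 |>.2
    rw [hA2]
    nlinarith
  set ε := √(6 * L / d) with hε
  have hε0 : 0 ≤ ε := Real.sqrt_nonneg _
  have hε2 : ε ^ 2 = 6 * L / d := Real.sq_sqrt (by positivity)
  have hεd : ε ^ 2 * d = 6 * L := by rw [hε2]; field_simp
  have hεδ : ε ≤ δ / 10 := by
    refine abs_le_of_sq_le_sq' ?_ (by positivity) |>.2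
    rw [hε2, div_le_iff₀ hd]
    nlinarith
  have hdθ : d * (A / r) = r * A := by rw [← hrd]; field_simp
  have hθδ : A / r ≤ δ / 20 := by
    rw [div_le_iff₀ hr0]
    refine abs_le_of_sq_le_sq' ?_ (by positivity) |>.2
    rw [hA2, mul_pow, hrd]
    nlinarith
  have hθ0 : 0 ≤ A / r := by positivity
  refine ⟨A / r, ε, hθ0, by linarith, hε0, by linarith, hεd, ?_, ?_, ?_, ?_⟩
  · rw [hdθ]; nlinarith
  · nlinarith
  · have e1 : d * (A / r) ^ 2 = (1 + δ) * L := by rw [← hA2, ← hrd]; field_simp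
    have e2 : r * (A / r) = A := by field_simp
    have e3 : d * (A / r) ^ 3 = (1 + δ) * L * (A / r) := by rw [← e1]; ring
    have e4 : (1 + δ) * L * (A / r) ≤ (1 + δ) * L * (δ / 20) :=
      mul_le_mul_of_nonneg_left hθδ (by positivity)
    have e5 : δ * (δ * L) ≤ 1 / 4 * (δ * L) := mul_le_mul_of_nonneg_right hδ' (by positivity)
    nlinarith
  · rw [le_div_iff₀ (by positivity), hdθ]
    have e1 : (r * A - 2 * r) ^ 2 = d * (A - 2) ^ 2 := by rw [← hrd]; ring
    rw [e1]
    have e2 : (1 + δ / 4) * L * (1 + ε) ≤ (1 + δ / 4) * L * (1 + δ / 10) :=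
      mul_le_mul_of_nonneg_left (by linarith) (by positivity)
    have e3 : (1 + δ / 4) * L * (1 + δ / 10) ≤ (A - 2) ^ 2 := by
      have : δ * (δ * L) ≤ 1 / 4 * (δ * L) := mul_le_mul_of_nonneg_right hδ' (by positivity)
      nlinarith
    nlinarith [mul_le_mul_of_nonneg_left (e2.trans e3) hd.le]

end Parameters

/-! ### Assembly of the probabilistic bound. -/

section Main

open Filter in
theorem exists_forall_le_log (a : ℝ) : ∃ N : ℕ, ∀ n : ℕ, N ≤ n → a ≤ Real.log n :=
  eventually_atTop.1 ((Real.tendsto_log_atTop.comp tendsto_natCast_atTop_atTop).eventually_ge_atTop a)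

/-- With high probability over sign vectors, navigable graphs have large average degree. -/
theorem exists_forall_le_unifProb_navigable {δ η : ℝ} (hδ : 0 < δ) (hδ' : δ ≤ 1 / 4)
    (hη : 0 < η) :
    ∃ N : ℕ, ∀ n : ℕ, N ≤ n → ∀ d : ℕ, 600 * Real.log n ≤ δ ^ 2 * d →
      1 - η ≤ unifProb fun s : Fin n → Fin d → Bool => ∀ G : Digraph (Fin n),
        Navigable G (fun u v : EuclideanSpace ℝ (Fin d) => dist u v) (signPoints s) →
          (n : ℝ) ^ (1 / 2 - δ) ≤ averageDegree G := by
  -- Makes `(K + 1) * δ / 4` at least `3`, so that `n ^ 2 * (n ^ (-δ / 4)) ^ (K + 1)` is at most `1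
  -- / n`.
  set K := ⌈12 / δ⌉₊ with hK
  have hKδ : 12 ≤ δ * K := by
    have := Nat.le_ceil (12 / δ)
    rw [div_le_iff₀ hδ] at this
    linarith
  obtain ⟨N, hN⟩ := exists_forall_le_log
    -- The three entries serve the parameter choice, the absorption of the factor `K + 1` into the
    -- slack `n ^ (0.055 * δ)`, and the total failure probability `(1 + 1 + 22) / n`. The `11`
    -- rounds up `8 * 4 / 3`.
    (max (50 / δ ^ 2) (max (Real.log (11 * (K + 1)) / (0.055 * δ)) (Real.log (24 / η))))
  refine ⟨max N 2, fun n hn d hd => ?_⟩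
  have hn2 : 2 ≤ n := (le_max_right _ _).trans hn
  have hn0 : (0 : ℝ) < n := by exact_mod_cast (by omega : 0 < n)
  have hNn := hN n ((le_max_left _ _).trans hn)
  rw [max_le_iff, max_le_iff] at hNn
  obtain ⟨hL1, hL2, hL3⟩ := hNn
  set L := Real.log n with hL
  have hexp : Real.exp L = n := Real.exp_log hn0
  rw [div_le_iff₀ (by positivity)] at hL1 hL2
  have hL0 : 0 < L := by
    by_contra h
    push Not at h
    nlinarith [sq_nonneg δ]
  have hKexp : 11 * ((K : ℝ) + 1) ≤ Real.exp (0.055 * δ * L) := by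
    rw [← Real.log_le_iff_le_exp (by positivity)]
    linarith
  have hηexp : 24 * Real.exp (-L) ≤ η := by
    rw [Real.log_le_iff_le_exp (by positivity), hexp, div_le_iff₀ hη] at hL3
    rw [Real.exp_neg, hexp, ← div_eq_mul_inv, div_le_iff₀ hn0]
    linarith
  have hd0 : 0 < d := by
    rcases Nat.eq_zero_or_pos d with rfl | h
    · simp only [Nat.cast_zero, mul_zero] at hd
      linarith
    · exact h
  have hd0' : (0 : ℝ) < d := by exact_mod_cast hd0
  obtain ⟨θ, ε, hθ0, hθ, hε0, hε1, hεd, hτ0, hτd, hlow, hup⟩ :=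
    exists_parameters hδ hδ' hd0' (by linarith) hd
  set τ := d * θ - 2 * √(d : ℝ) with hτ
  set p₀ := 3 / 4 * Real.exp (-((1 / 2 + 0.945 * δ) * L)) with hp₀
  have hp₀0 : 0 < p₀ := by positivity
  have hp : p₀ ≤ unifProb (fun u : Fin d → Bool => τ ≤ ∑ k, boolSign (u k)) := by
    refine le_trans ?_ (le_unifProb_sum hd0 hθ0 hθ)
    exact mul_le_mul_of_nonneg_left (Real.exp_le_exp.2 (neg_le_neg hlow)) (by norm_num)
  have hnsq : (n : ℝ) ^ 2 = Real.exp (2 * L) := by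
    rw [← hexp, ← Real.exp_nat_mul]; norm_num
  have hmain := unifProb_relCount_ge hn2 hd0 hε0 hτ0 K hp₀0 hp
  refine le_trans ?_ (hmain.trans (unifProb_mono fun s hs G hG => ?_))
  · have h1 : (n : ℝ) ^ 2 * Real.exp (-(ε ^ 2 * d) / 2) = Real.exp (-L) := by
      rw [hεd, hnsq, ← Real.exp_add]
      congr 1; ring
    have h2 : (n : ℝ) ^ 2 * (n * Real.exp (-τ ^ 2 / (d * (1 + ε)))) ^ (K + 1) ≤
        Real.exp (-L) := by
      have h3 : n * Real.exp (-τ ^ 2 / (d * (1 + ε))) ≤ Real.exp (-(δ / 4 * L)) := by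
        nth_rewrite 1 [← hexp]
        rw [← Real.exp_add, neg_div]
        refine Real.exp_le_exp.2 ?_
        linarith
      calc _ ≤ (n : ℝ) ^ 2 * Real.exp (-(δ / 4 * L)) ^ (K + 1) := by gcongr
        _ = Real.exp (2 * L + ((K + 1 : ℕ) : ℝ) * (-(δ / 4 * L))) := by
            rw [hnsq, ← Real.exp_nat_mul, Real.exp_add]
        _ ≤ _ := by
            refine Real.exp_le_exp.2 ?_
            push_cast
            nlinarith [mul_le_mul_of_nonneg_right hKδ hL0.le, mul_pos hδ hL0]
    have h4 : 16 / ((n : ℝ) ^ 2 * p₀) ≤ 22 * Real.exp (-L) := by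
      have h5 : 3 / 4 * Real.exp L ≤ (n : ℝ) ^ 2 * p₀ := by
        have : (n : ℝ) ^ 2 * p₀ = 3 / 4 * Real.exp (2 * L - (1 / 2 + 0.945 * δ) * L) := by
          rw [hnsq, hp₀, sub_eq_add_neg, Real.exp_add]; ring
        rw [this]
        refine mul_le_mul_of_nonneg_left (Real.exp_le_exp.2 ?_) (by norm_num)
        nlinarith
      rw [div_le_iff₀ (by positivity)]
      have h6 := mul_le_mul_of_nonneg_left h5 (Real.exp_pos (-L)).le
      rw [mul_left_comm, ← Real.exp_add, neg_add_cancel, Real.exp_zero] at h6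
      linarith
    linarith
  · obtain ⟨ho, hc, hrel⟩ := hs
    have hE := hrel.trans (hG.relCount_le hd0 hε1 hτd ho hc)
    rw [averageDegree, le_div_iff₀ hn0]
    set E : ℝ := (Set.ncard {e : Fin n × Fin n | G.Adj e.1 e.2} : ℝ) with hEdef
    rw [Real.rpow_def_of_pos hn0, ← hL]
    -- The exponent splits as `2 - (1 / 2 + 0.945 * δ) = 0.055 * δ + (1 / 2 - δ) + 1`.
    have hkey : (n : ℝ) ^ 2 * p₀ =
        3 / 4 * (Real.exp (0.055 * δ * L) * (Real.exp (L * (1 / 2 - δ)) * n)) := by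
      rw [hnsq, hp₀]
      nth_rewrite 1 [← hexp]
      rw [← Real.exp_add, ← Real.exp_add, mul_left_comm, ← Real.exp_add]
      congr 2; ring
    rw [hkey] at hE
    set B := Real.exp (L * (1 / 2 - δ)) * n with hB
    have hB0 : 0 ≤ B := by positivity
    have hK1 : (0 : ℝ) < K + 1 := by positivity
    have h8 := mul_le_mul_of_nonneg_right hKexp hB0
    refine le_of_mul_le_mul_left ?_ hK1
    have h9 := mul_nonneg hK1.le hB0
    linarith

theorem unifProb_ne_ge {n d : ℕ} {i j : Fin n} (hij : i ≠ j) :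
    1 - (2 ^ d : ℝ)⁻¹ ≤ unifProb fun s : Fin n → Fin d → Bool => s i ≠ s j := by
  have := unifProb_pair_le hij (fun u v : Fin d → Bool => u = v) _
    fun v => (unifProb_eq_const v).le
  rw [show (fun s : Fin n → Fin d → Bool => s i ≠ s j) = fun s => ¬ s i = s j from rfl,
    unifProb_not]
  linarith

end Main

theorem theorem2 :
    ∃ c : ℝ, 0 < c ∧ ∃ C : ℝ, 0 < C ∧
      ∀ δ : ℝ, 0 < δ → ∀ η : ℝ, 0 < η → ∃ N : ℕ, ∀ n : ℕ, N ≤ n →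
        ∀ d : ℕ, c / δ ^ 2 * Real.logb 2 (n : ℝ) ≤ (d : ℝ) →
          ∀ (Ω : Type*) [MeasurableSpace Ω] (P : Measure Ω) [IsProbabilityMeasure P]
            (X : Fin n → Fin d → Ω → ℝ), IsRandomSignMatrix P X →
            1 - η ≤ P.real {ω | ∀ G : Digraph (Fin n),
              Navigable G (fun u v : EuclideanSpace ℝ (Fin d) => dist u v) (rowPoints X ω) →
                C * (n : ℝ) ^ (1 / 2 - δ) ≤ averageDegree G} := by
  -- `21600 = 600 * 16 * (3 / 2) ^ 2`: for `δ` between `1 / 4` and `3 / 2` the bound is applied at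
  -- `1 / 4`, and this constant still supplies the dimension needed there.
  refine ⟨21600, by norm_num, 1, one_pos, fun δ hδ η hη => ?_⟩
  rcases lt_or_ge δ (3 / 2) with hδ2 | hδ2
  · obtain ⟨N, hN⟩ := exists_forall_le_unifProb_navigable (δ := min δ (1 / 4)) (η := η)
      (lt_min hδ (by norm_num)) (min_le_right _ _) hη
    refine ⟨max N 1, fun n hn d hd Ω _ P _ X hX => ?_⟩
    have hn1 : (1 : ℝ) ≤ n := by exact_mod_cast (le_max_right _ _).trans hn
    have hlog : 0 ≤ Real.log n := Real.log_nonneg hn1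
    have hlogb : Real.log n ≤ Real.logb 2 n := by
      rw [Real.logb, le_div_iff₀ (Real.log_pos (by norm_num))]
      nlinarith [Real.log_two_lt_d9]
    rw [div_mul_eq_mul_div, div_le_iff₀ (by positivity)] at hd
    refine (hN n ((le_max_left _ _).trans hn) d ?_).trans
      (hX.unifProb_le _ _ fun s ω hs hω G hG => ?_)
    · rcases le_total δ (1 / 4) with h | h
      · rw [min_eq_left h]
        linarith
      · rw [min_eq_right h]
        have : (d : ℝ) * δ ^ 2 ≤ d * (3 / 2) ^ 2 := by gcongr
        linarith
    · rw [rowPoints_eq_signPoints hω] at hG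
      rw [one_mul]
      refine le_trans (Real.rpow_le_rpow_of_exponent_le hn1 ?_) (hs G hG)
      linarith [min_le_left δ (1 / 4)]
  -- For large `δ` the dimension may be too small for the main argument, but the target is at most
  -- `1 / n`, so a single edge suffices. It exists as soon as two points differ, and `d` is large
  -- enough for that.
  · obtain ⟨N, hN⟩ := exists_forall_le_log (Real.log (1 / η) / (21600 / δ ^ 2))
    refine ⟨max N 2, fun n hn d hd Ω _ P _ X hX => ?_⟩
    have hn2 : 2 ≤ n := (le_max_right _ _).trans hn
    have hn1 : (1 : ℝ) ≤ n := by exact_mod_cast (by omega : 1 ≤ n)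
    have hn0 : (0 : ℝ) < n := by linarith
    have hlog := hN n ((le_max_left _ _).trans hn)
    have h2d : (2 ^ d : ℝ)⁻¹ ≤ η := by
      rw [inv_le_comm₀ (by positivity) hη, ← one_div,
        ← Real.log_le_log_iff (by positivity) (by positivity), Real.log_pow]
      rw [div_le_iff₀ (by positivity)] at hlog
      have hl2 : 0 < Real.log 2 := Real.log_pos (by norm_num)
      rw [Real.logb, ← mul_div_assoc, div_le_iff₀ hl2] at hd
      linarith
    have hij : (⟨0, by omega⟩ : Fin n) ≠ ⟨1, by omega⟩ := by simp
    refine le_trans ?_ ((unifProb_ne_ge (d := d) hij).trans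
      (hX.unifProb_le _ _ fun s ω hs hω G hG => ?_))
    · linarith
    · rw [rowPoints_eq_signPoints hω] at hG
      have hE := hG.one_le_edges fun h => hs ((signPoints_eq_iff s _ _).1 h)
      have hE' : (1 : ℝ) ≤ Set.ncard {e : Fin n × Fin n | G.Adj e.1 e.2} := by exact_mod_cast hE
      rw [one_mul, averageDegree, le_div_iff₀ hn0]
      refine le_trans ?_ hE'
      calc (n : ℝ) ^ (1 / 2 - δ) * n ≤ (n : ℝ) ^ (-1 : ℝ) * n := by
            gcongr
            linarith
        _ = 1 := by rw [Real.rpow_neg_one, inv_mul_cancel₀ hn0.ne']
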